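/- Let $X$ be a compact abelian group with a translation-invariant metric $d$ inducing its topology, let $\mathscr B$ be its Borel $\sigma$-algebra and $\mu$ its normalized Haar measure, and let $Tx=x+x_0$ be an ergodic rotation of $(X,\mathscr B,\mu)$ which is aperiodic (that is, for every $n\ge 1$, $T^nx\neq x$ for $\mu$-a.e. $x$). Let $f\in L^\infty(X,\mathscr B,\mu)$ be real-valued with $f\ge c$ for some constant $c>0$, and write $f^{(n)}(x)=f(x)+f(Tx)+\dots+f(T^{n-1}x)$ for $n\ge 1$. Let $P'\subset\mathbb R$ be compact and $\eta_0>0$. Assume that for every $0<\eta<\eta_0$ and every $\epsilon>0$ there is $\kappa>0$ such that for every $N\in\mathbb N$ there are $\delta>0$ and $Z'\in\mathscr B$ with $\mu(Z')>1-\epsilon$ with the following property: if $x,x'\in Z'$ and $0<d(x,x')<\delta$, then there are integers $M_1,M_2,L_1,L_2\ge N$ with $\frac{L_1}{M_1},\frac{L_2}{M_2}\ge\kappa$ and a number $p\in P'$ such that $$\frac1{L_1}\left|\{n\in\mathbb Z\cap[M_1,M_1+L_1]:\ |f^{(n)}(x)-f^{(n)}(x')-p|<\epsilon\}\right|>1-\epsilon$$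 and $$\frac1{L_2}\left|\{n\in\mathbb Z\cap[M_2,M_2+L_2]:\ |f^{(n)}(x)-f^{(n)}(x')-p-\eta|<\epsilon\}\right|>1-\epsilon .$$ Let $\mathcal T^f=(T^f_t)_{t\in\mathbb R}$ be the special flow over $T$ under $f$: it acts on $X^f=\{(x,s)\in X\times\mathbb R:\ 0\le s<f(x)\}$, equipped with the restriction $\mu^f$ of $\mu\otimes\mathrm{Leb}$, by $T^f_t(x,s)=(T^nx,\,s+t-f^{(n)}(x))$, where $n\in\mathbb Z$ is the unique integer with $f^{(n)}(x)\le s+t<f^{(n+1)}(x)$ (and $f^{(0)}=0$, $f^{(-n)}(x)=-f^{(n)}(T^{-n}x)$). Then: 1. $\mathcal T^f$ is weakly mixing: if $s\in\mathbb R$ and $F\in L^2(X^f,\mu^f;\mathbb C)$ satisfy, for every $t\in\mathbb R$, $F\circ T^f_t=e^{2\pi i st}F$ $\mu^f$-a.e., then $F$ is $\mu^f$-a.e. constant. 2. $\mathcal T^f$ has the cocycle Ratner property with the set $$P=(P'+[-\eta_0,\eta_0])\setminus\left(-\tfrac{\eta_0}4,\tfrac{\eta_0}4\right),$$ that is, $P$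 is a compact subset of $\mathbb R\setminus\{0\}$, and for every $\epsilon>0$ there is $\kappa>0$ such that for every $N\in\mathbb N$ there are $\delta>0$ and $Z\in\mathscr B$ with $\mu(Z)>1-\epsilon$ with the following property: if $x,x'\in Z$ and $0<d(x,x')<\delta$, then there are integers $M,L\ge N$ with $\frac LM\ge\kappa$ and $p\in P$ such that $$\frac1L\left|\{n\in\mathbb Z\cap[M,M+L]:\ |f^{(n)}(x)-f^{(n)}(x')-p|<\epsilon\}\right|>1-\epsilon .$$ -/

import Mathlib

open MeasureTheory
open scoped ENNReal Pointwise

namespace SpecialFlow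

/-- The cocycle `f^{(n)}(x)`, `n ∈ ℤ`, generated by `f` over an invertible map `T`:
`f^{(n)}(x) = f(x) + f(Tx) + ... + f(T^{n-1}x)` for `n ≥ 0` and
`f^{(-n)}(x) = -f^{(n)}(T^{-n}x)`. -/
def cocycle {X : Type*} (T : Equiv.Perm X) (f : X → ℝ) : ℤ → X → ℝ
  | Int.ofNat n, x => birkhoffSum T f n x
  | Int.negSucc n, x => -birkhoffSum T f (n + 1) ((T ^ Int.negSucc n) x)

theorem cocycle_natCast {X : Type*} (T : Equiv.Perm X) (f : X → ℝ) (n : ℕ) (x : X) :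
    cocycle T f (n : ℤ) x = birkhoffSum T f n x := rfl

theorem cocycle_add_one {X : Type*} (T : Equiv.Perm X) (f : X → ℝ) (n : ℤ) (x : X) :
    cocycle T f (n + 1) x = cocycle T f n x + f ((T ^ n) x) := by
  rcases n with n | n
  · change birkhoffSum T f (n + 1) x = birkhoffSum T f n x + f ((T ^ (n : ℤ)) x)
    rw [birkhoffSum_succ, zpow_natCast, Equiv.Perm.coe_pow]
  · have h2 : T ((T ^ Int.negSucc n) x) = (T ^ (Int.negSucc n + 1)) x := by
      rw [add_comm, zpow_add, zpow_one, Equiv.Perm.mul_apply]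
    have h1 : cocycle T f (Int.negSucc n + 1) x
        = -birkhoffSum T f n ((T ^ (Int.negSucc n + 1)) x) := by
      rcases n with _ | n
      · change birkhoffSum T f 0 x = -birkhoffSum T f 0 _
        simp
      · rfl
    rw [h1, ← h2]
    change _ = -birkhoffSum T f (n + 1) _ + _
    rw [birkhoffSum_succ']
    ring

/-- The phase space `X^f = {(x, s) : 0 ≤ s < f x}`. -/
def space {X : Type*} (f : X → ℝ) : Set (X × ℝ) :=
  {z | 0 ≤ z.2 ∧ z.2 < f z.1}

/-- The measure `μ^f`: the restriction of `μ ⊗ Lebesgue` to `X^f`. -/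
noncomputable def measure {X : Type*} [MeasurableSpace X] (μ : Measure X) (f : X → ℝ) :
    Measure (X × ℝ) :=
  (μ.prod volume).restrict (space f)

/-- The integer `n` with `f^{(n)}(x) ≤ u < f^{(n+1)}(x)`. It exists and is unique as soon as `f`
is bounded below by a positive constant along the orbit of `x`
(see `existsUnique_crossing`). -/
noncomputable def crossing {X : Type*} (T : Equiv.Perm X) (f : X → ℝ) (x : X) (u : ℝ) : ℤ :=
  Classical.epsilon fun n : ℤ => cocycle T f n x ≤ u ∧ u < cocycle T f (n + 1) x

theorem existsUnique_crossing {X : Type*} (T : Equiv.Perm X) (f : X → ℝ) (x : X) {c : ℝ}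
    (hc : 0 < c) (hf : ∀ k : ℤ, c ≤ f ((T ^ k) x)) (u : ℝ) :
    ∃! n : ℤ, cocycle T f n x ≤ u ∧ u < cocycle T f (n + 1) x := by
  have step : ∀ n : ℤ, cocycle T f n x + c ≤ cocycle T f (n + 1) x := fun n => by
    rw [cocycle_add_one]; linarith [hf n]
  have gap : ∀ (n : ℤ) (k : ℕ), cocycle T f n x + k * c ≤ cocycle T f (n + k) x := by
    intro n k
    induction k with
    | zero => simp
    | succ k ih =>
      have := step (n + k)
      push_cast
      rw [← add_assoc]
      linarith
  have mono : ∀ m n : ℤ, m ≤ n → cocycle T f m x ≤ cocycle T f n x := by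
    intro m n h
    obtain ⟨k, rfl⟩ := Int.le.dest h
    have := gap m k
    have : 0 ≤ (k : ℝ) * c := by positivity
    linarith
  have zero : cocycle T f 0 x = 0 := by
    change birkhoffSum T f 0 x = 0
    simp
  obtain ⟨K, hK⟩ := exists_nat_gt (|u| / c)
  rw [div_lt_iff₀ hc] at hK
  have up : u < cocycle T f K x := by
    have := gap 0 K
    rw [zero, zero_add, zero_add] at this
    linarith [le_abs_self u]
  have low : cocycle T f (-K) x ≤ u := by
    have := gap (-K) K
    rw [neg_add_cancel, zero] at this
    linarith [neg_abs_le u]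
  obtain ⟨n, hn, hmax⟩ := Int.exists_greatest_of_bdd
    (P := fun n : ℤ => cocycle T f n x ≤ u)
    ⟨K, fun z hz => by
      by_contra! h
      exact absurd (mono _ _ h.le) (not_le.2 (lt_of_le_of_lt hz up))⟩ ⟨-K, low⟩
  refine ⟨n, ⟨hn, ?_⟩, ?_⟩
  · by_contra! h
    have := hmax _ h
    omega
  · rintro m ⟨hm1, hm2⟩
    refine le_antisymm (hmax _ hm1) ?_
    by_contra! h
    exact absurd (mono (m + 1) n h) (not_le.2 (lt_of_le_of_lt hn hm2))

/-- The special flow `T^f_t(x, s) = (T^n x, s + t - f^{(n)}(x))`, where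
`f^{(n)}(x) ≤ s + t < f^{(n+1)}(x)`. It acts on `X^f`; its values outside `X^f` are never used,
since the measure `measure μ f` is carried by `X^f`. -/
noncomputable def flow {X : Type*} (T : Equiv.Perm X) (f : X → ℝ) (t : ℝ) (z : X × ℝ) : X × ℝ :=
  let n := crossing T f z.1 (z.2 + t)
  ((T ^ n) z.1, z.2 + t - cocycle T f n z.1)

end SpecialFlow

/-- Weak mixing of a flow `(S_t)` on `(Ω, ν)`: every square-integrable eigenfunction of the
flow is constant almost everywhere. (The case `s = 0` is ergodicity.) -/
def IsWeaklyMixingFlow {Ω : Type*} [MeasurableSpace Ω] (S : ℝ → Ω → Ω) (ν : Measure Ω) : Prop :=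
  ∀ (s : ℝ) (F : Ω → ℂ), MemLp F 2 ν →
    (∀ t : ℝ, ∀ᵐ z ∂ν, F (S t z) = Complex.exp (2 * Real.pi * s * t * Complex.I) * F z) →
    ∃ a : ℂ, ∀ᵐ z ∂ν, F z = a

/-- Almost every point is not periodic. -/
def IsAperiodic {X : Type*} [MeasurableSpace X] (T : X → X) (μ : Measure X) : Prop :=
  ∀ n : ℕ, 0 < n → ∀ᵐ x ∂μ, T^[n] x ≠ x

/-- The integers `n ∈ [M, M + L]` with `|f^{(n)}(x) - f^{(n)}(x') - p| < ε`. -/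
def driftTimes {X : Type*} (T : X → X) (f : X → ℝ) (x x' : X) (p ε : ℝ) (M L : ℕ) : Set ℕ :=
  {n | M ≤ n ∧ n ≤ M + L ∧ |birkhoffSum T f n x - birkhoffSum T f n x' - p| < ε}

/-- The cocycle Ratner property, with the compact set `P ⊆ ℝ \ {0}`, of the special flow given
by `T` and `f`. The constant `κ` depends on `ε` only; `δ` and `Z` depend on `ε` and `N`. -/
def HasCocycleRatnerProperty {X : Type*} [MetricSpace X] [MeasurableSpace X]
    (T : X → X) (μ : Measure X) (f : X → ℝ) (P : Set ℝ) : Prop :=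
  IsCompact P ∧ (0 : ℝ) ∉ P ∧
  ∀ ε : ℝ, 0 < ε → ∃ κ : ℝ, 0 < κ ∧ ∀ N : ℕ,
    ∃ δ : ℝ, 0 < δ ∧ ∃ Z : Set X, MeasurableSet Z ∧ 1 - ε < μ.real Z ∧
      ∀ x ∈ Z, ∀ x' ∈ Z, 0 < dist x x' → dist x x' < δ →
        ∃ M L : ℕ, N ≤ M ∧ N ≤ L ∧ κ ≤ (L : ℝ) / M ∧
          ∃ p ∈ P, 1 - ε < ((driftTimes T f x x' p ε M L).ncard : ℝ) / L

/-! An eigenfunction with eigenvalue `s` is a phase along the fibres times some `g` on the base with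
`g ∘ T = e^{2πisf} g` (`exists_transfer_function`). By ergodicity `|g|` is constant, and if it is
nonzero it may be taken to be 1. Iterating, `e^{2πis(f^{(n)}(x) - f^{(n)}(x'))}` is close to 1 as
soon as `g x` is close to `g x'` and `g (T^n x)` to `g (T^n x')`. Since `T` is an isometry, this
holds for close `x, x'` whenever the four points avoid a small set `B` off which `g` is nearly
continuous. The maximal inequality `mul_measureReal_exists_lt_birkhoffSum_le` supplies many points
whose orbits visit `B` rarely at every time scale, so a window with `L ≥ κM` contains a drift time
avoiding `B`. Hence `e^{2πisp}` and `e^{2πis(p+η)}` are both near 1, which forces `e^{2πisη} = 1`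
for all `η < η₀`, so `s = 0`; ergodicity then makes `g` constant. The Ratner property needs only `η
= η₀/2`: the drifts `p` and `p + η₀/2` cannot both be close to 0. -/

/-! ### Maximal ergodic inequality -/

section Maximal

/-- The function `max_{0 ≤ n ≤ N} u^{(n)}`, where `u^{(n)}` is the `n`-th Birkhoff sum. -/
def birkhoffMax {α : Type*} (T : α → α) (u : α → ℝ) : ℕ → α → ℝ
  | 0, _ => 0
  | N + 1, x => max 0 (u x + birkhoffMax T u N (T x))

variable {α : Type*} {T : α → α} {u : α → ℝ}

theorem birkhoffMax_nonneg (N : ℕ) (x : α) : 0 ≤ birkhoffMax T u N x := by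
  cases N with
  | zero => exact le_rfl
  | succ N => exact le_max_left _ _

theorem birkhoffMax_le_succ (N : ℕ) (x : α) : birkhoffMax T u N x ≤ birkhoffMax T u (N + 1) x := by
  induction N generalizing x with
  | zero => exact birkhoffMax_nonneg 1 x
  | succ N ih => exact max_le_max le_rfl (add_le_add le_rfl (ih (T x)))

theorem birkhoffSum_le_birkhoffMax (N : ℕ) (x : α) : birkhoffSum T u N x ≤ birkhoffMax T u N x := by
  induction N generalizing x with
  | zero => simp [birkhoffMax]
  | succ N ih =>
    rw [birkhoffSum_succ']
    exact le_max_of_le_right (add_le_add le_rfl (ih (T x)))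

theorem exists_birkhoffSum_eq_birkhoffMax (N : ℕ) (x : α) :
    ∃ n, birkhoffSum T u n x = birkhoffMax T u N x := by
  induction N generalizing x with
  | zero => exact ⟨0, by simp [birkhoffMax]⟩
  | succ N ih =>
    rcases le_total (u x + birkhoffMax T u N (T x)) 0 with h | h
    · exact ⟨0, by simp [birkhoffMax, h]⟩
    · obtain ⟨n, hn⟩ := ih (T x)
      exact ⟨n + 1, by rw [birkhoffSum_succ', hn, birkhoffMax, max_eq_right h]⟩

variable [MeasurableSpace α] {μ : Measure α}

theorem measurable_birkhoffMax (hT : Measurable T) (hu : Measurable u) (N : ℕ) :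
    Measurable (birkhoffMax T u N) := by
  induction N with
  | zero => exact measurable_const
  | succ N ih => exact measurable_const.max (hu.add (ih.comp hT))

theorem integrable_birkhoffMax [IsFiniteMeasure μ] (hT : MeasurePreserving T μ μ)
    (hu : Integrable u μ) (N : ℕ) : Integrable (birkhoffMax T u N) μ := by
  induction N with
  | zero => exact integrable_zero _ _ _
  | succ N ih => exact (integrable_zero _ _ _).sup (hu.add (hT.integrable_comp_of_integrable ih))

/-- Finite-time maximal ergodic theorem. -/
theorem setIntegral_birkhoffMax_pos_nonneg [IsFiniteMeasure μ] (hT : MeasurePreserving T μ μ)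
    (hm : Measurable u) (hu : Integrable u μ) (N : ℕ) :
    0 ≤ ∫ x in {x | 0 < birkhoffMax T u N x}, u x ∂μ := by
  cases N with
  | zero => simp [birkhoffMax]
  | succ N =>
    set A := {x | 0 < birkhoffMax T u (N + 1) x} with hA
    have hAm : MeasurableSet A :=
      measurableSet_lt measurable_const (measurable_birkhoffMax hT.measurable hm _)
    have hi := integrable_birkhoffMax hT hu (N + 1)
    have hi' : Integrable (fun x => birkhoffMax T u (N + 1) (T x)) μ :=
      hT.integrable_comp_of_integrable hi
    -- On `A` the maximum is attained at a positive time, so it equals `u` plus the shorter maximum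
    -- at `T x`. The left side is nonnegative: the maximum vanishes off `A`, and composing with `T`
    -- preserves its full integral.
    have h1 : ∫ x in A, (birkhoffMax T u (N + 1) x - birkhoffMax T u (N + 1) (T x)) ∂μ
        ≤ ∫ x in A, u x ∂μ := by
      refine setIntegral_mono_on (hi.sub hi').integrableOn hu.integrableOn hAm fun x hx => ?_
      have h2 : birkhoffMax T u (N + 1) x = u x + birkhoffMax T u N (T x) := by
        rcases max_cases 0 (u x + birkhoffMax T u N (T x)) with h | h
        · exact absurd (show 0 < max 0 (u x + birkhoffMax T u N (T x)) from hx) (by simp [h.1])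
        · exact h.1
      have := birkhoffMax_le_succ (T := T) (u := u) N (T x)
      linarith
    refine le_trans ?_ h1
    have h3 : ∫ x in A, birkhoffMax T u (N + 1) x ∂μ = ∫ x, birkhoffMax T u (N + 1) x ∂μ := by
      refine setIntegral_eq_integral_of_forall_compl_eq_zero fun x hx => ?_
      exact le_antisymm (not_lt.1 hx) (birkhoffMax_nonneg _ _)
    have h4 : ∫ x in A, birkhoffMax T u (N + 1) (T x) ∂μ
        ≤ ∫ x, birkhoffMax T u (N + 1) (T x) ∂μ :=
      setIntegral_le_integral hi' (ae_of_all _ fun x => birkhoffMax_nonneg _ _)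
    have h5 : ∫ x, birkhoffMax T u (N + 1) (T x) ∂μ = ∫ x, birkhoffMax T u (N + 1) x ∂μ := by
      have := integral_map (μ := μ) hT.aemeasurable (f := birkhoffMax T u (N + 1))
        (by rw [hT.map_eq]; exact hi.aestronglyMeasurable)
      rw [hT.map_eq] at this
      exact this.symm
    rw [integral_sub hi.integrableOn hi'.integrableOn]
    linarith

/-- The weak-type maximal inequality for the frequency of visits to a set `B`. -/
theorem mul_measureReal_exists_lt_birkhoffSum_le [IsFiniteMeasure μ] (hT : MeasurePreserving T μ μ)
    {B : Set α} (hB : MeasurableSet B) (r : ℝ) :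
    r * μ.real {x | ∃ n : ℕ, r * n < birkhoffSum T (B.indicator 1) n x} ≤ μ.real B := by
  set u : α → ℝ := fun x => B.indicator 1 x - r with hu_def
  have hBi : Integrable (B.indicator (1 : α → ℝ)) μ := (integrable_const (1 : ℝ)).indicator hB
  have hu : Integrable u μ := hBi.sub (integrable_const r)
  have hm : Measurable u := (measurable_const.indicator hB).sub measurable_const
  have hsum : ∀ n x, birkhoffSum T u n x = birkhoffSum T (B.indicator 1) n x - r * n := by
    intro n x
    simp [birkhoffSum, hu_def, Finset.sum_sub_distrib, mul_comm]
  have hU : {x | ∃ n : ℕ, r * n < birkhoffSum T (B.indicator 1) n x}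
      = ⋃ N, {x | 0 < birkhoffMax T u N x} := by
    ext x
    simp only [Set.mem_ofPred_eq, Set.mem_iUnion]
    constructor
    · rintro ⟨n, hn⟩
      refine ⟨n, lt_of_lt_of_le ?_ (birkhoffSum_le_birkhoffMax n x)⟩
      rw [hsum]; linarith
    · rintro ⟨N, hN⟩
      obtain ⟨n, hn⟩ := exists_birkhoffSum_eq_birkhoffMax (T := T) (u := u) N x
      refine ⟨n, ?_⟩
      rw [← hn, hsum] at hN
      linarith
  have hmono : Monotone fun N => {x | 0 < birkhoffMax T u N x} :=
    monotone_nat_of_le_succ fun N x hx => lt_of_lt_of_le hx (birkhoffMax_le_succ N x)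
  have hlim := (tendsto_measure_iUnion_atTop (μ := μ) hmono)
  rw [← hU] at hlim
  have hlim' := ((ENNReal.tendsto_toReal (measure_ne_top μ _)).comp hlim).const_mul r
  refine le_of_tendsto hlim' (Filter.Eventually.of_forall fun N => ?_)
  have h0 := setIntegral_birkhoffMax_pos_nonneg hT hm hu N
  rw [integral_sub hBi.integrableOn (integrable_const r).integrableOn, setIntegral_const,
    setIntegral_indicator hB] at h0
  simp only [Pi.one_apply, setIntegral_const, smul_eq_mul, mul_one] at h0
  have h1 : μ.real ({x | 0 < birkhoffMax T u N x} ∩ B) ≤ μ.real B :=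
    measureReal_mono Set.inter_subset_right
  change r * μ.real {x | 0 < birkhoffMax T u N x} ≤ μ.real B
  linarith

end Maximal

/-! ### Rotations and non-atomic measures -/

theorem iterate_addRight {X : Type*} [AddCommGroup X] (x₀ : X) (n : ℕ) (x : X) :
    (Equiv.addRight x₀)^[n] x = x + n • x₀ := by
  induction n with
  | zero => simp
  | succ n ih =>
    rw [Function.iterate_succ_apply', ih, succ_nsmul]
    exact add_assoc _ _ _

/-- A rotation of infinite order forces Haar measure to have no atoms. -/
theorem measure_singleton_eq_zero_of_isAperiodic {X : Type*} [AddCommGroup X] [MeasurableSpace X]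
    [MeasurableSingletonClass X] [MeasurableAdd X] (μ : Measure X) [μ.IsAddLeftInvariant]
    [IsProbabilityMeasure μ] {x₀ : X} (hap : IsAperiodic (Equiv.addRight x₀) μ) (x : X) :
    μ {x} = 0 := by
  have hord : ∀ n : ℕ, 0 < n → n • x₀ ≠ 0 := by
    intro n hn h0
    obtain ⟨y, hy⟩ := (hap n hn).exists
    apply hy
    rw [iterate_addRight, h0, add_zero]
  have hinj : Function.Injective fun n : ℕ => n • x₀ :=
    injective_nsmul_iff_not_isOfFinAddOrder.2 fun hfin => by
      obtain ⟨n, hn, h⟩ := isOfFinAddOrder_iff_nsmul_eq_zero.1 hfin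
      exact hord n hn h
  have hinf := Set.infinite_range_of_injective hinj
  -- Translation makes all atoms equally heavy; a positive mass would give the infinitely many
  -- multiples of `x₀` infinite measure.
  have heq : ∀ y, μ {y} = μ {x} := by
    intro y
    have := measure_preimage_add μ (x - y) {x}
    rwa [show (fun h => x - y + h) ⁻¹' {x} = {y} by
      ext z
      simp only [Set.mem_preimage, Set.mem_singleton_iff]
      constructor
      · intro h; rw [sub_add_eq_add_sub, sub_eq_iff_eq_add] at h; exact add_left_cancel h
      · rintro rfl; abel] at this
  by_contra hne
  exact measure_ne_top μ _ (hinf.meas_eq_top ⟨μ {x}, hne, fun y _ => (heq y).ge⟩)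

/-- In a compact metric space with a non-atomic measure, a set of positive measure contains two
distinct points which are arbitrarily close to each other. -/
theorem exists_dist_pos_lt_of_measure_ne_zero {X : Type*} [MetricSpace X] [CompactSpace X]
    [MeasurableSpace X] {μ : Measure X} (hμ : ∀ x : X, μ {x} = 0) {A : Set X} (hA : μ A ≠ 0)
    {δ : ℝ} (hδ : 0 < δ) : ∃ x ∈ A, ∃ x' ∈ A, 0 < dist x x' ∧ dist x x' < δ := by
  obtain ⟨t, -, ht, hcov⟩ :=
    Metric.finite_approx_of_totallyBounded (isCompact_univ (X := X)).totallyBounded (δ / 2)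
      (half_pos hδ)
  obtain ⟨y, hy⟩ : ∃ y ∈ t, μ (A ∩ Metric.ball y (δ / 2)) ≠ 0 := by
    by_contra! h
    apply hA
    have := (measure_biUnion_null_iff (μ := μ) (I := t)
      (s := fun y => A ∩ Metric.ball y (δ / 2)) ht.countable).2 h
    refine measure_mono_null (fun x hx => ?_) this
    obtain ⟨y, hy, hxy⟩ := Set.mem_iUnion₂.1 (hcov (Set.mem_univ x))
    exact Set.mem_iUnion₂.2 ⟨y, hy, hx, hxy⟩
  have hnt : (A ∩ Metric.ball y (δ / 2)).Nontrivial := by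
    rw [← Set.not_subsingleton_iff]
    intro hs
    rcases hs.eq_empty_or_singleton with h | ⟨z, h⟩
    · exact hy.2 (by rw [h, measure_empty])
    · exact hy.2 (by rw [h, hμ])
  obtain ⟨x, hx, x', hx', hne⟩ := hnt
  refine ⟨x, hx.1, x', hx'.1, dist_pos.2 hne, ?_⟩
  have := dist_triangle_right x x' y
  have h1 := Metric.mem_ball.1 hx.2
  have h2 := Metric.mem_ball.1 hx'.2
  linarith

/-! ### Characters of the real line -/

namespace SpecialFlow

/-- The character `t ↦ e^{2πist}` of `ℝ`. -/
noncomputable def phase (s t : ℝ) : ℂ := Complex.exp (2 * Real.pi * s * t * Complex.I)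

theorem phase_eq_exp_ofReal (s t : ℝ) :
    phase s t = Complex.exp ((2 * Real.pi * s * t : ℝ) * Complex.I) := by
  rw [phase]; push_cast; rfl

theorem phase_zero (s : ℝ) : phase s 0 = 1 := by simp [phase]

theorem phase_add (s t t' : ℝ) : phase s (t + t') = phase s t * phase s t' := by
  simp only [phase, ← Complex.exp_add]
  congr 1
  push_cast
  ring

theorem phase_mul_phase_neg (s t : ℝ) : phase s t * phase s (-t) = 1 := by
  rw [← phase_add, add_neg_cancel, phase_zero]

theorem norm_phase (s t : ℝ) : ‖phase s t‖ = 1 := by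
  rw [phase_eq_exp_ofReal, Complex.norm_exp_ofReal_mul_I]

theorem measurable_phase (s : ℝ) : Measurable (phase s) := by
  unfold phase
  fun_prop

theorem norm_phase_sub_phase (s t t' : ℝ) :
    ‖phase s t - phase s t'‖ = ‖phase s (t - t') - 1‖ := by
  have : phase s t - phase s t' = phase s t' * (phase s (t - t') - 1) := by
    rw [mul_sub, ← phase_add]
    simp
  rw [this, norm_mul, norm_phase, one_mul]

theorem norm_phase_sub_phase_le (s t t' : ℝ) :
    ‖phase s t - phase s t'‖ ≤ 2 * Real.pi * |s| * |t - t'| := by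
  rw [norm_phase_sub_phase, phase_eq_exp_ofReal, mul_comm _ Complex.I]
  refine (Real.norm_exp_I_mul_ofReal_sub_one_le).trans (le_of_eq ?_)
  rw [Real.norm_eq_abs, abs_mul, abs_mul, abs_of_pos Real.two_pi_pos]

/-- For `η < 1/|s|` the product `sη` would be an integer of modulus less than 1. -/
theorem eq_zero_of_phase_eq_one {s η₀ : ℝ} (hη₀ : 0 < η₀)
    (h : ∀ η, 0 < η → η < η₀ → phase s η = 1) : s = 0 := by
  by_contra hs
  have hs' : 0 < |s| := abs_pos.2 hs
  obtain ⟨η, hη, hle⟩ := exists_between (show 0 < min η₀ (1 / |s|) by positivity)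
  have h1 := h η hη (hle.trans_le (min_le_left _ _))
  rw [phase, Complex.exp_eq_one_iff] at h1
  obtain ⟨n, hn⟩ := h1
  have h2 : s * η = n := by
    have h3 : (2 * Real.pi * Complex.I : ℂ) ≠ 0 := by simp [Real.pi_ne_zero]
    have h4 : ((s * η : ℝ) : ℂ) = ((n : ℝ) : ℂ) := by
      apply mul_right_cancel₀ h3
      push_cast
      rw [← hn]
      ring
    exact_mod_cast h4
  have h5 : |s * η| < 1 := by
    rw [abs_mul, abs_of_pos hη]
    have := hle.trans_le (min_le_right _ _)
    rwa [lt_div_iff₀ hs', mul_comm] at this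
  rw [h2] at h5
  have h6 : n = 0 := by
    have : |n| < 1 := by exact_mod_cast h5
    exact Int.abs_lt_one_iff.1 this
  rw [h6, Int.cast_zero] at h2
  rcases mul_eq_zero.1 h2 with h | h
  · exact hs h
  · exact hη.ne' h

/-! ### From eigenfunctions to the cohomological equation -/

/-- An eigenfunction `F` of a special flow has the form `F(x, u) = e^{2πisu} g(x)`, where `g`
solves the cohomological equation `g(Tx) = e^{2πisf(x)} g(x)`. Only times at which the flow
jumps at most once are used. -/
theorem exists_transfer_function {X : Type*} [MeasurableSpace X] {μ : Measure X} [SFinite μ]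
    {T : X → X} (hT : Measurable T) {f : X → ℝ} (hf : Measurable f) {c : ℝ} (hc : 0 < c)
    (hcf : ∀ x, c ≤ f x) (s : ℝ) {F : X × ℝ → ℂ} (hF : Measurable F)
    (h0 : ∀ t : ℝ, ∀ᵐ z ∂μ.prod volume, z.2 ∈ Set.Ico 0 (f z.1) →
      z.2 + t ∈ Set.Ico 0 (f z.1) → F (z.1, z.2 + t) = phase s t * F z)
    (h1 : ∀ t : ℝ, ∀ᵐ z ∂μ.prod volume, z.2 ∈ Set.Ico 0 (f z.1) →
      z.2 + t - f z.1 ∈ Set.Ico 0 (f (T z.1)) → F (T z.1, z.2 + t - f z.1) = phase s t * F z) :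
    ∃ g : X → ℂ, Measurable g ∧ (∀ᵐ x ∂μ, g (T x) = phase s (f x) * g x) ∧
      ∀ᵐ z ∂μ.prod volume, z.2 ∈ Set.Ico 0 (f z.1) → F z = phase s z.2 * g z.1 := by
  have hph := measurable_phase s
  -- `H` is `F` with the expected phase removed: `h0` makes it constant on almost every fibre, and
  -- `h1` relates the constants of consecutive fibres.
  set H : X × ℝ → ℂ := fun z => phase s (-z.2) * F z with hH
  have hHm : Measurable H := by fun_prop
  have hIco : ∀ {φ ψ : ℝ × (X × ℝ) → ℝ}, Measurable φ → Measurable ψ →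
      MeasurableSet {p | φ p ∈ Set.Ico 0 (ψ p)} := fun hφ hψ =>
    (measurableSet_le measurable_const hφ).inter (measurableSet_lt hφ hψ)
  -- The null set in `h0` depends on `t`; Fubini moves the quantifier over `t` inside, at the price
  -- of almost every `t`.
  have a0 : ∀ᵐ z ∂μ.prod volume, ∀ᵐ t : ℝ, z.2 ∈ Set.Ico 0 (f z.1) →
      z.2 + t ∈ Set.Ico 0 (f z.1) → F (z.1, z.2 + t) = phase s t * F z := by
    refine (Measure.ae_ae_comm (μ := (volume : Measure ℝ)) (ν := μ.prod volume) ?_).1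
      (ae_of_all _ h0)
    refine ((hIco (by fun_prop) (by fun_prop)).imp ((hIco (by fun_prop) (by fun_prop)).imp
      (measurableSet_eq_fun ?_ ?_))) <;> fun_prop
  have a1 : ∀ᵐ z ∂μ.prod volume, ∀ᵐ t : ℝ, z.2 ∈ Set.Ico 0 (f z.1) →
      z.2 + t - f z.1 ∈ Set.Ico 0 (f (T z.1)) →
        F (T z.1, z.2 + t - f z.1) = phase s t * F z := by
    refine (Measure.ae_ae_comm (μ := (volume : Measure ℝ)) (ν := μ.prod volume) ?_).1
      (ae_of_all _ h1)
    refine ((hIco (by fun_prop) (by fun_prop)).imp ((hIco (by fun_prop) (by fun_prop)).imp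
      (measurableSet_eq_fun ?_ ?_))) <;> fun_prop
  have b0 : ∀ᵐ z ∂μ.prod volume, z.2 ∈ Set.Ico 0 (f z.1) → ∀ᵐ v : ℝ,
      v ∈ Set.Ico 0 (f z.1) → H (z.1, v) = H z := by
    filter_upwards [a0] with z hz hzf
    have := (measurePreserving_add_right volume (-z.2)).quasiMeasurePreserving.ae hz
    filter_upwards [this] with v hv hvf
    have h2 := hv hzf (by simpa using hvf)
    rw [show z.2 + (v + -z.2) = v by ring] at h2
    simp only [hH]
    rw [h2, ← mul_assoc, ← phase_add]
    congr 2
    ring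
  have b1 : ∀ᵐ z ∂μ.prod volume, z.2 ∈ Set.Ico 0 (f z.1) → ∀ᵐ v : ℝ,
      v ∈ Set.Ico 0 (f (T z.1)) → H (T z.1, v) = phase s (f z.1) * H z := by
    filter_upwards [a1] with z hz hzf
    have := (measurePreserving_add_right volume (f z.1 - z.2)).quasiMeasurePreserving.ae hz
    filter_upwards [this] with v hv hvf
    have h3 : z.2 + (v + (f z.1 - z.2)) - f z.1 = v := by ring
    have h2 := hv hzf (by rwa [h3])
    rw [h3] at h2
    simp only [hH]
    rw [h2, ← mul_assoc, ← phase_add, ← mul_assoc, ← phase_add]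
    congr 2
    ring
  -- Averaging over `[0, c)`, which lies in every fibre, reads off the fibre constant measurably.
  set g : X → ℂ := fun x => (c : ℂ)⁻¹ * ∫ v in Set.Ico 0 c, H (x, v) with hg
  have hgm : Measurable g :=
    (hHm.stronglyMeasurable.integral_prod_right
      (ν := volume.restrict (Set.Ico 0 c))).measurable.const_mul _
  have hgval : ∀ (x : X) (a : ℂ), (∀ᵐ v : ℝ, v ∈ Set.Ico 0 (f x) → H (x, v) = a) → g x = a := by
    intro x a hxa
    have : ∫ v in Set.Ico 0 c, H (x, v) = ∫ _ in Set.Ico 0 c, a := by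
      refine setIntegral_congr_ae measurableSet_Ico ?_
      filter_upwards [hxa] with v hv hvc
      exact hv ⟨hvc.1, hvc.2.trans_le (hcf x)⟩
    simp only [hg, this, setIntegral_const]
    simp [hc.le, hc.ne']
  have hgH : ∀ᵐ z ∂μ.prod volume, z.2 ∈ Set.Ico 0 (f z.1) → g z.1 = H z := by
    filter_upwards [b0] with z hz hzf
    exact hgval _ _ (hz hzf)
  refine ⟨g, hgm, ?_, ?_⟩
  · have b2 : ∀ᵐ z ∂μ.prod volume, z.2 ∈ Set.Ico 0 (f z.1) →
        g (T z.1) = phase s (f z.1) * g z.1 := by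
      filter_upwards [hgH, b1] with z h2 h3 hzf
      rw [h2 hzf]
      exact hgval _ _ (h3 hzf)
    filter_upwards [Measure.ae_ae_of_ae_prod b2] with x hx
    -- The relation does not involve the height, so one height in `[0, c)` suffices.
    by_contra hne
    have h4 : ∀ᵐ u : ℝ, u ∉ Set.Ico 0 c := by
      filter_upwards [hx] with u hu huc
      exact hne (hu ⟨huc.1, huc.2.trans_le (hcf x)⟩)
    have h5 := measure_eq_zero_iff_ae_notMem.2 h4
    simp at h5
    linarith
  · filter_upwards [hgH] with z hz hzf
    rw [hz hzf, hH]
    simp only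
    rw [← mul_assoc, phase_mul_phase_neg, one_mul]

end SpecialFlow

/-! ### Drift forces trivial phases -/

/-- If the orbits of `x` and `x'` visit `B` rarely, then some drift time avoids `B` for both. -/
theorem exists_mem_driftTimes_iterate_notMem {X : Type*} {T : X → X} {f : X → ℝ} {B : Set X}
    {x x' : X} {p ε κ r : ℝ} {M L : ℕ} (hr : 0 ≤ r)
    (hx : ∀ n : ℕ, birkhoffSum T (B.indicator 1) n x ≤ r * n)
    (hx' : ∀ n : ℕ, birkhoffSum T (B.indicator 1) n x' ≤ r * n)
    (hM : 1 ≤ M) (hL : 1 ≤ L) (hκ : 0 < κ) (hML : κ ≤ (L : ℝ) / M) (hrκ : r * (1 / κ + 2) ≤ 1 / 4)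
    (hε : ε ≤ 1 / 4) (hp : 1 - ε < ((driftTimes T f x x' p ε M L).ncard : ℝ) / L) :
    ∃ n ∈ driftTimes T f x x' p ε M L, T^[n] x ∉ B ∧ T^[n] x' ∉ B := by
  classical
  -- Otherwise more than `3L/4` drift times are covered by two sets of at most `L/4` visits each.
  by_contra! hcon
  have hMpos : (0 : ℝ) < M := by exact_mod_cast hM
  have hLpos : (1 : ℝ) ≤ L := by exact_mod_cast hL
  set V : X → Finset ℕ := fun y => (Finset.range (M + L + 1)).filter fun n => T^[n] y ∈ B with hV
  have hVcard : ∀ y, (∀ n : ℕ, birkhoffSum T (B.indicator 1) n y ≤ r * n) →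
      ((V y).card : ℝ) ≤ L / 4 := by
    intro y hy
    have h1 : ((V y).card : ℝ) = birkhoffSum T (B.indicator 1) (M + L + 1) y := by
      simp [hV, birkhoffSum, Set.indicator_apply, Finset.sum_boole]
    rw [h1]
    refine (hy _).trans ?_
    have h2 : (M : ℝ) ≤ L * (1 / κ) := by
      rw [le_div_iff₀ hMpos] at hML
      rw [mul_one_div, le_div_iff₀ hκ]
      linarith
    have h3 : ((M + L + 1 : ℕ) : ℝ) ≤ L * (1 / κ + 2) := by
      push_cast
      linarith
    calc r * ((M + L + 1 : ℕ) : ℝ) ≤ r * (L * (1 / κ + 2)) := by gcongr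
      _ = L * (r * (1 / κ + 2)) := by ring
      _ ≤ L * (1 / 4) := by gcongr
      _ = L / 4 := by ring
  have hsub : driftTimes T f x x' p ε M L ⊆ ((V x ∪ V x' : Finset ℕ) : Set ℕ) := by
    intro n hn
    have hle : n ≤ M + L := hn.2.1
    by_cases hb : T^[n] x ∈ B
    · simp [hV, hle, hb]
    · simp [hV, hle, hcon n hn hb]
  have hcard : (driftTimes T f x x' p ε M L).ncard ≤ (V x).card + (V x').card := by
    refine (Set.ncard_le_ncard hsub (Finset.finite_toSet _)).trans ?_
    rw [Set.ncard_coe_finset]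
    exact Finset.card_union_le _ _
  have hcard' : ((driftTimes T f x x' p ε M L).ncard : ℝ) ≤ (V x).card + (V x').card := by
    exact_mod_cast hcard
  rw [lt_div_iff₀ (by linarith)] at hp
  have := hVcard x hx
  have := hVcard x' hx'
  nlinarith

namespace SpecialFlow

/-- The cohomological equation bounds the phase of the actual drift by the changes of `g` at times 0
and `n`, costing `3τ` each; replacing the drift by `p` costs a further `τ`. -/
theorem norm_phase_sub_one_le_of_mem_driftTimes {X : Type*} {T : X → X} {f : X → ℝ} {g : X → ℂ}
    {s p ε τ : ℝ} {x x' : X} {M L n : ℕ} (hn : n ∈ driftTimes T f x x' p ε M L)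
    (hx : g (T^[n] x) = phase s (birkhoffSum T f n x) * g x)
    (hx' : g (T^[n] x') = phase s (birkhoffSum T f n x') * g x') (hg1 : ‖g x'‖ = 1)
    (hd : ‖g x - g x'‖ ≤ 3 * τ) (hdn : ‖g (T^[n] x) - g (T^[n] x')‖ ≤ 3 * τ)
    (hε : 2 * Real.pi * |s| * ε ≤ τ) : ‖phase s p - 1‖ ≤ 7 * τ := by
  set a := birkhoffSum T f n x
  set a' := birkhoffSum T f n x'
  have hdrift : |a - a' - p| < ε := hn.2.2
  have h1 : ‖phase s (a - a') - 1‖ ≤ 6 * τ := by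
    rw [← norm_phase_sub_phase]
    calc ‖phase s a - phase s a'‖ = ‖(phase s a - phase s a') * g x'‖ := by
          rw [norm_mul, hg1, mul_one]
      _ = ‖(g (T^[n] x) - g (T^[n] x')) - phase s a * (g x - g x')‖ := by
          rw [hx, hx']
          congr 1
          ring
      _ ≤ ‖g (T^[n] x) - g (T^[n] x')‖ + ‖phase s a * (g x - g x')‖ := norm_sub_le _ _
      _ ≤ 3 * τ + 3 * τ := by
          rw [norm_mul, norm_phase, one_mul]
          exact add_le_add hdn hd
      _ = 6 * τ := by ring
  have h2 : ‖phase s p - phase s (a - a')‖ ≤ τ := by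
    refine (norm_phase_sub_phase_le _ _ _).trans (le_trans ?_ hε)
    rw [abs_sub_comm]
    have := Real.pi_pos
    gcongr
  calc ‖phase s p - 1‖ = ‖(phase s p - phase s (a - a')) + (phase s (a - a') - 1)‖ := by
        congr 1; ring
    _ ≤ τ + 6 * τ := (norm_add_le _ _).trans (add_le_add h2 h1)
    _ = 7 * τ := by ring

/-- A unimodular solution of the cohomological equation over a rotation forces `e^{2πisη} = 1`
whenever the cocycle drifts by two amounts differing by `η`. -/
theorem phase_eq_one_of_drift {X : Type*} [AddCommGroup X] [MetricSpace X]
    [IsTopologicalAddGroup X] [CompactSpace X] [MeasurableSpace X] [BorelSpace X]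
    (hd : ∀ x y z : X, dist (x + z) (y + z) = dist x y)
    (μ : Measure X) [μ.IsAddHaarMeasure] [IsProbabilityMeasure μ]
    {x₀ : X} (hap : IsAperiodic (Equiv.addRight x₀) μ) {f : X → ℝ} {P' : Set ℝ} {η : ℝ}
    (h : ∀ ε : ℝ, 0 < ε → ∃ κ : ℝ, 0 < κ ∧ ∀ N : ℕ,
      ∃ δ : ℝ, 0 < δ ∧ ∃ Z' : Set X, MeasurableSet Z' ∧ 1 - ε < μ.real Z' ∧
        ∀ x ∈ Z', ∀ x' ∈ Z', 0 < dist x x' → dist x x' < δ →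
          ∃ M₁ M₂ L₁ L₂ : ℕ, N ≤ M₁ ∧ N ≤ M₂ ∧ N ≤ L₁ ∧ N ≤ L₂ ∧
            κ ≤ (L₁ : ℝ) / M₁ ∧ κ ≤ (L₂ : ℝ) / M₂ ∧
            ∃ p ∈ P',
              1 - ε < ((driftTimes (Equiv.addRight x₀) f x x' p ε M₁ L₁).ncard : ℝ) / L₁ ∧
              1 - ε < ((driftTimes (Equiv.addRight x₀) f x x' (p + η) ε M₂ L₂).ncard : ℝ) / L₂)
    {s : ℝ} {g : X → ℂ} (hgm : Measurable g) (hg1 : ∀ᵐ x ∂μ, ‖g x‖ = 1)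
    (hgT : ∀ᵐ x ∂μ, g (Equiv.addRight x₀ x) = phase s (f x) * g x) : phase s η = 1 := by
  set T : X → X := ⇑(Equiv.addRight x₀) with hTdef
  have hT : MeasurePreserving T μ μ := measurePreserving_add_right μ x₀
  have hiter : ∀ᵐ x ∂μ, ∀ n : ℕ, g (T^[n] x) = phase s (birkhoffSum T f n x) * g x := by
    have h1 : ∀ᵐ x ∂μ, ∀ n : ℕ, g (T (T^[n] x)) = phase s (f (T^[n] x)) * g (T^[n] x) :=
      ae_all_iff.2 fun n => (hT.iterate n).quasiMeasurePreserving.ae hgT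
    filter_upwards [h1] with x hx n
    induction n with
    | zero => simp [phase_zero]
    | succ n ih =>
      rw [Function.iterate_succ_apply', hx n, ih, birkhoffSum_succ, phase_add]
      ring
  have hgi : Integrable g μ :=
    Integrable.of_bound hgm.aestronglyMeasurable 1 (hg1.mono fun x hx => hx.le)
  have hdist : ∀ (n : ℕ) (x x' : X), dist (T^[n] x) (T^[n] x') = dist x x' := fun n x x' => by
    rw [hTdef, iterate_addRight, iterate_addRight, hd]
  have key : ∀ τ : ℝ, 0 < τ → ‖phase s η - 1‖ ≤ 14 * τ := by
    intro τ hτ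
    have hpi := Real.two_pi_pos
    -- The bound `1/4` serves the counting, the other one the phase error; the `+ 1` covers `s = 0`.
    set ε := min (1 / 4) (τ / (2 * Real.pi * |s| + 1)) with hε
    have hεpos : 0 < ε := by positivity
    have hε4 : ε ≤ 1 / 4 := min_le_left _ _
    have hετ : 2 * Real.pi * |s| * ε ≤ τ := by
      have h1 : ε ≤ τ / (2 * Real.pi * |s| + 1) := min_le_right _ _
      rw [le_div_iff₀ (by positivity)] at h1
      nlinarith
    obtain ⟨κ, hκ, hκN⟩ := h ε hεpos
    -- `N = 1` suffices because the visit bound below holds at all times.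
    obtain ⟨δ, hδ, Z', -, hZ', hpair⟩ := hκN 1
    set r := 1 / (4 * (1 / κ + 2)) with hr
    have hrpos : 0 < r := by positivity
    have hrκ : r * (1 / κ + 2) ≤ 1 / 4 := by
      rw [hr]
      have : (0 : ℝ) < 1 / κ + 2 := by positivity
      exact le_of_eq (by field_simp)
    have hr1 : r < 1 := by
      have : 0 < 1 / κ := by positivity
      nlinarith
    -- With error `τr/4`, Markov gives `μ B ≤ r/4` and the maximal inequality `μ E ≤ 1/4`, less than
    -- `μ Z' > 3/4`.
    obtain ⟨φ, hφ, hφi⟩ := hgi.exists_boundedContinuous_integral_sub_le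
      (show 0 < τ * (r / 4) by positivity)
    set B : Set X := {x | τ ≤ ‖g x - φ x‖} with hB
    have hBm : MeasurableSet B :=
      measurableSet_le measurable_const (hgm.sub φ.continuous.measurable).norm
    have hBμ : μ.real B ≤ r / 4 := by
      have h1 := mul_meas_ge_le_integral_of_nonneg (μ := μ)
        (ae_of_all _ fun x => norm_nonneg (g x - φ x)) (hgi.sub hφi).norm τ
      exact le_of_mul_le_mul_left (h1.trans hφ) hτ
    set E : Set X := {x | ∃ n : ℕ, r * n < birkhoffSum T (B.indicator 1) n x} with hE
    have hEμ : μ.real E ≤ 1 / 4 := by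
      have h1 := mul_measureReal_exists_lt_birkhoffSum_le hT hBm r
      nlinarith
    obtain ⟨δ', hδ', hφδ⟩ := Metric.uniformContinuous_iff.1
      (CompactSpace.uniformContinuous_of_continuous φ.continuous) τ hτ
    set G : Set X := {x | ‖g x‖ = 1 ∧
      ∀ n : ℕ, g (T^[n] x) = phase s (birkhoffSum T f n x) * g x} with hG
    have hGμ : μ Gᶜ = 0 := hg1.and hiter
    have hA : μ ((Z' ∩ G) \ E) ≠ 0 := by
      intro h0
      have hsub : Z' ⊆ ((Z' ∩ G) \ E ∪ Gᶜ) ∪ E := by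
        intro x hx
        by_cases h1 : x ∈ E
        · exact Or.inr h1
        · by_cases h2 : x ∈ G
          · exact Or.inl (Or.inl ⟨⟨hx, h2⟩, h1⟩)
          · exact Or.inl (Or.inr h2)
      have h1 : μ.real ((Z' ∩ G) \ E ∪ Gᶜ) = 0 := by
        rw [measureReal_def, measure_union_null h0 hGμ, ENNReal.toReal_zero]
      have h2 := (measureReal_mono (μ := μ) hsub).trans (measureReal_union_le _ _)
      linarith
    obtain ⟨x, ⟨⟨hxZ, hxG⟩, hxE⟩, x', ⟨⟨hxZ', hxG'⟩, hxE'⟩, hpos, hlt⟩ :=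
      exists_dist_pos_lt_of_measure_ne_zero (measure_singleton_eq_zero_of_isAperiodic μ hap) hA
        (lt_min hδ hδ')
    have hxE : ∀ n : ℕ, birkhoffSum T (B.indicator 1) n x ≤ r * n := by
      simpa [hE] using hxE
    have hxE' : ∀ n : ℕ, birkhoffSum T (B.indicator 1) n x' ≤ r * n := by
      simpa [hE] using hxE'
    -- The sum at `n = 1` sees only `y` itself, and `r < 1`.
    have hnotB : ∀ y, (∀ n : ℕ, birkhoffSum T (B.indicator 1) n y ≤ r * n) → y ∉ B := by
      intro y hy hyB
      have := hy 1
      simp [birkhoffSum_one, hyB] at this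
      linarith
    have hclose : ∀ y y', y ∉ B → y' ∉ B → dist y y' = dist x x' → ‖g y - g y'‖ ≤ 3 * τ := by
      intro y y' hy hy' hyy
      have h1 : ‖g y - φ y‖ < τ := not_le.1 hy
      have h2 : ‖g y' - φ y'‖ < τ := not_le.1 hy'
      have h3 : ‖φ y - φ y'‖ < τ := by
        rw [← dist_eq_norm]
        exact hφδ (hyy ▸ hlt.trans_le (min_le_right _ _))
      calc ‖g y - g y'‖ = ‖(g y - φ y) + (φ y - φ y') - (g y' - φ y')‖ := by congr 1; ring
        _ ≤ ‖g y - φ y‖ + ‖φ y - φ y'‖ + ‖g y' - φ y'‖ :=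
          (norm_sub_le _ _).trans (add_le_add (norm_add_le _ _) le_rfl)
        _ ≤ 3 * τ := by linarith
    have hest : ∀ (q : ℝ) (M L : ℕ), 1 ≤ M → 1 ≤ L → κ ≤ (L : ℝ) / M →
        1 - ε < ((driftTimes T f x x' q ε M L).ncard : ℝ) / L → ‖phase s q - 1‖ ≤ 7 * τ := by
      intro q M L hM hL hML hq
      obtain ⟨n, hn, hnx, hnx'⟩ := exists_mem_driftTimes_iterate_notMem hrpos.le hxE hxE' hM hL hκ
        hML hrκ hε4 hq
      exact norm_phase_sub_one_le_of_mem_driftTimes hn (hxG.2 n) (hxG'.2 n) hxG'.1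
        (hclose x x' (hnotB x hxE) (hnotB x' hxE') rfl) (hclose _ _ hnx hnx' (hdist n x x')) hετ
    obtain ⟨M₁, M₂, L₁, L₂, hM₁, hM₂, hL₁, hL₂, hML₁, hML₂, p, -, hp₁, hp₂⟩ :=
      hpair x hxZ x' hxZ' hpos (hlt.trans_le (min_le_left _ _))
    have e₁ := hest p M₁ L₁ hM₁ hL₁ hML₁ hp₁
    have e₂ := hest (p + η) M₂ L₂ hM₂ hL₂ hML₂ hp₂
    calc ‖phase s η - 1‖ = ‖phase s (p + η) - phase s p‖ := by
          rw [norm_phase_sub_phase, add_sub_cancel_left]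
      _ = ‖(phase s (p + η) - 1) - (phase s p - 1)‖ := by congr 1; ring
      _ ≤ 7 * τ + 7 * τ := (norm_sub_le _ _).trans (add_le_add e₂ e₁)
      _ = 14 * τ := by ring
  rw [← sub_eq_zero, ← norm_le_zero_iff]
  refine le_of_forall_pos_le_add fun τ hτ => ?_
  have := key (τ / 14) (by positivity)
  linarith

/-! ### The special flow up to null sets -/

theorem cocycle_zero {X : Type*} (T : Equiv.Perm X) (f : X → ℝ) (x : X) : cocycle T f 0 x = 0 :=
  (cocycle_natCast T f 0 x).trans (birkhoffSum_zero _ _ _)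

theorem cocycle_one {X : Type*} (T : Equiv.Perm X) (f : X → ℝ) (x : X) :
    cocycle T f 1 x = f x := by
  simpa [cocycle_zero] using cocycle_add_one T f 0 x

theorem crossing_eq {X : Type*} (T : Equiv.Perm X) (f : X → ℝ) (x : X) {c : ℝ}
    (hc : 0 < c) (hf : ∀ k : ℤ, c ≤ f ((T ^ k) x)) {u : ℝ} {n : ℤ}
    (h : cocycle T f n x ≤ u) (h' : u < cocycle T f (n + 1) x) : crossing T f x u = n := by
  have hex := existsUnique_crossing T f x hc hf u
  exact hex.unique (Classical.epsilon_spec hex.exists) ⟨h, h'⟩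

theorem flow_eq_of_mem_Ico {X : Type*} (T : Equiv.Perm X) (f : X → ℝ) {c : ℝ}
    (hc : 0 < c) {z : X × ℝ} (hf : ∀ k : ℤ, c ≤ f ((T ^ k) z.1)) {t : ℝ}
    (h : z.2 + t ∈ Set.Ico 0 (f z.1)) : flow T f t z = (z.1, z.2 + t) := by
  have := crossing_eq T f z.1 hc hf (u := z.2 + t) (n := 0) (by simpa [cocycle_zero] using h.1)
    (by simpa [cocycle_one] using h.2)
  simp [flow, this, cocycle_zero]

theorem flow_eq_of_sub_mem_Ico {X : Type*} (T : Equiv.Perm X) (f : X → ℝ) {c : ℝ}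
    (hc : 0 < c) {z : X × ℝ} (hf : ∀ k : ℤ, c ≤ f ((T ^ k) z.1)) {t : ℝ}
    (h : z.2 + t - f z.1 ∈ Set.Ico 0 (f (T z.1))) :
    flow T f t z = (T z.1, z.2 + t - f z.1) := by
  have := crossing_eq T f z.1 hc hf (u := z.2 + t) (n := 1)
    (by rw [cocycle_one]; linarith [h.1])
    (by rw [cocycle_add_one, cocycle_one, zpow_one]; linarith [h.2])
  simp [flow, this, cocycle_one]

theorem measure_congr {X : Type*} [MeasurableSpace X] {μ : Measure X} [SFinite μ] {f f' : X → ℝ}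
    (h : f =ᵐ[μ] f') : measure μ f = measure μ f' := by
  refine Measure.restrict_congr_set ?_
  filter_upwards [Measure.quasiMeasurePreserving_fst.ae h] with z hz
  apply propext
  change (0 ≤ z.2 ∧ z.2 < f z.1) ↔ (0 ≤ z.2 ∧ z.2 < f' z.1)
  rw [hz]

theorem ae_measure_iff {X : Type*} [MeasurableSpace X] {μ : Measure X} {f : X → ℝ}
    (hf : Measurable f) {p : X × ℝ → Prop} :
    (∀ᵐ z ∂measure μ f, p z) ↔ ∀ᵐ z ∂μ.prod volume, z.2 ∈ Set.Ico 0 (f z.1) → p z :=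
  ae_restrict_iff' ((measurableSet_le measurable_const measurable_snd).inter
    (measurableSet_lt measurable_snd (hf.comp measurable_fst)))

/-- Eigenfunctions of the special flow over a rotation come from the cohomological equation. -/
theorem exists_transfer_function_of_eigenfunction {X : Type*} [AddCommGroup X]
    [MeasurableSpace X] [MeasurableAdd X] (μ : Measure X) [μ.IsAddLeftInvariant]
    [IsProbabilityMeasure μ] (x₀ : X) {f : X → ℝ} (hf : AEMeasurable f μ)
    {c : ℝ} (hc : 0 < c) (hcf : ∀ᵐ x ∂μ, c ≤ f x) (s : ℝ) {F : X × ℝ → ℂ}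
    (hF : AEMeasurable F (measure μ f))
    (hFt : ∀ t : ℝ, ∀ᵐ z ∂measure μ f,
      F (flow (Equiv.addRight x₀) f t z) = phase s t * F z) :
    ∃ g : X → ℂ, Measurable g ∧ (∀ᵐ x ∂μ, g (Equiv.addRight x₀ x) = phase s (f x) * g x) ∧
      ∀ᵐ z ∂measure μ f, F z = phase s z.2 * g z.1 := by
  obtain ⟨f', hf'm, hcf', hff'⟩ : ∃ f' : X → ℝ, Measurable f' ∧ (∀ x, c ≤ f' x) ∧ f =ᵐ[μ] f' := by
    refine ⟨fun x => max c (hf.mk f x), measurable_const.max hf.measurable_mk,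
      fun x => le_max_left _ _, ?_⟩
    filter_upwards [hf.ae_eq_mk, hcf] with x hx hxc
    rw [← hx, max_eq_right hxc]
  set T : Equiv.Perm X := Equiv.addRight x₀ with hT
  have hTm : MeasurePreserving T μ μ := measurePreserving_add_right μ x₀
  -- The flow still uses `f`, whose values along the whole orbit determine the crossing index.
  have horb : ∀ᵐ x ∂μ, ∀ k : ℤ, f ((T ^ k) x) = f' ((T ^ k) x) := by
    refine ae_all_iff.2 fun k => ?_
    rw [hT, Equiv.zsmul_addRight]
    exact (measurePreserving_add_right μ (k • x₀)).quasiMeasurePreserving.ae hff'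
  have horb' : ∀ᵐ z ∂μ.prod (volume : Measure ℝ), ∀ k : ℤ, f ((T ^ k) z.1) = f' ((T ^ k) z.1) :=
    Measure.quasiMeasurePreserving_fst.ae horb
  rw [measure_congr hff'] at hF hFt ⊢
  have hFF' := (ae_measure_iff hf'm).1 hF.ae_eq_mk
  have hFt' := fun t => (ae_measure_iff hf'm).1 (hFt t)
  have h0 : ∀ t : ℝ, ∀ᵐ z ∂μ.prod volume, z.2 ∈ Set.Ico 0 (f' z.1) →
      z.2 + t ∈ Set.Ico 0 (f' z.1) → hF.mk F (z.1, z.2 + t) = phase s t * hF.mk F z := by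
    intro t
    have hq : MeasurePreserving (fun z : X × ℝ => (z.1, z.2 + t)) (μ.prod volume)
        (μ.prod volume) :=
      (MeasurePreserving.id μ).prod (measurePreserving_add_right volume t)
    filter_upwards [horb', hFF', hFt' t, hq.quasiMeasurePreserving.ae hFF']
      with z ho h1 h2 h3 hz hzt
    have hfz : f z.1 = f' z.1 := ho 0
    rw [← h1 hz, ← h3 hzt, ← h2 hz, flow_eq_of_mem_Ico T f hc (fun k => (ho k) ▸ hcf' _)
      (by rwa [hfz])]
  have h1 : ∀ t : ℝ, ∀ᵐ z ∂μ.prod volume, z.2 ∈ Set.Ico 0 (f' z.1) →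
      z.2 + t - f' z.1 ∈ Set.Ico 0 (f' (T z.1)) →
        hF.mk F (T z.1, z.2 + t - f' z.1) = phase s t * hF.mk F z := by
    intro t
    -- A fibrewise translation over the rotation pulls the null set where `F` differs from its
    -- representative back to a null set.
    have hq : MeasurePreserving (fun z : X × ℝ => (T z.1, z.2 + t - f' z.1)) (μ.prod volume)
        (μ.prod volume) :=
      hTm.skew_product (g := fun x u => u + t - f' x) (by fun_prop)
        (ae_of_all _ fun x => by
          have := (measurePreserving_add_right (volume : Measure ℝ) (t - f' x)).map_eq
          simpa only [add_sub_assoc] using this)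
    filter_upwards [horb', hFF', hFt' t, hq.quasiMeasurePreserving.ae hFF']
      with z ho h1 h2 h3 hz hzt
    have hfz : f z.1 = f' z.1 := ho 0
    have hfTz : f (T z.1) = f' (T z.1) := ho 1
    rw [← h1 hz, ← h3 hzt, ← h2 hz, flow_eq_of_sub_mem_Ico T f hc (fun k => (ho k) ▸ hcf' _)
      (by rwa [hfz, hfTz]), hfz]
  obtain ⟨g, hgm, hgT, hgF⟩ := exists_transfer_function hTm.measurable hf'm hc hcf' s
    hF.measurable_mk h0 h1
  refine ⟨g, hgm, ?_, ?_⟩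
  · filter_upwards [hgT, hff'] with x hx hxf
    rw [hx, hxf]
  · rw [ae_measure_iff hf'm]
    filter_upwards [hFF', hgF] with z h2 h3 hz
    rw [h2 hz, h3 hz]

end SpecialFlow

/-! ### Weak mixing and the Ratner property -/

theorem mainTheorem3 {X : Type*} [AddCommGroup X] [MetricSpace X] [IsTopologicalAddGroup X]
    [CompactSpace X] [MeasurableSpace X] [BorelSpace X]
    (hd : ∀ x y z : X, dist (x + z) (y + z) = dist x y)
    (μ : Measure X) [μ.IsAddHaarMeasure] [IsProbabilityMeasure μ]
    (x₀ : X) (hT : Ergodic (Equiv.addRight x₀) μ) (hap : IsAperiodic (Equiv.addRight x₀) μ)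
    (f : X → ℝ) (hf : MemLp f ∞ μ) (hpos : ∃ c : ℝ, 0 < c ∧ ∀ᵐ x ∂μ, c ≤ f x)
    (P' : Set ℝ) (hP' : IsCompact P') (η₀ : ℝ) (hη₀ : 0 < η₀)
    (h : ∀ η : ℝ, 0 < η → η < η₀ → ∀ ε : ℝ, 0 < ε → ∃ κ : ℝ, 0 < κ ∧ ∀ N : ℕ,
      ∃ δ : ℝ, 0 < δ ∧ ∃ Z' : Set X, MeasurableSet Z' ∧ 1 - ε < μ.real Z' ∧
        ∀ x ∈ Z', ∀ x' ∈ Z', 0 < dist x x' → dist x x' < δ →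
          ∃ M₁ M₂ L₁ L₂ : ℕ, N ≤ M₁ ∧ N ≤ M₂ ∧ N ≤ L₁ ∧ N ≤ L₂ ∧
            κ ≤ (L₁ : ℝ) / M₁ ∧ κ ≤ (L₂ : ℝ) / M₂ ∧
            ∃ p ∈ P',
              1 - ε < ((driftTimes (Equiv.addRight x₀) f x x' p ε M₁ L₁).ncard : ℝ) / L₁ ∧
              1 - ε < ((driftTimes (Equiv.addRight x₀) f x x' (p + η) ε M₂ L₂).ncard : ℝ) / L₂) :
    IsWeaklyMixingFlow (SpecialFlow.flow (Equiv.addRight x₀) f) (SpecialFlow.measure μ f) ∧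
    HasCocycleRatnerProperty (Equiv.addRight x₀) μ f
      ((P' + Set.Icc (-η₀) η₀) \ Set.Ioo (-(η₀ / 4)) (η₀ / 4)) := by
  constructor
  · intro s F hF hFt
    obtain ⟨c, hc, hcf⟩ := hpos
    obtain ⟨g, hgm, hgT, hgF⟩ := SpecialFlow.exists_transfer_function_of_eigenfunction μ x₀
      hf.aestronglyMeasurable.aemeasurable hc hcf s hF.aestronglyMeasurable.aemeasurable hFt
    have hlift : ∀ {p : X → Prop}, (∀ᵐ x ∂μ, p x) → ∀ᵐ z ∂SpecialFlow.measure μ f, p z.1 :=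
      fun hp => ae_restrict_of_ae (Measure.quasiMeasurePreserving_fst.ae hp)
    obtain ⟨r, hr⟩ : ∃ r : ℝ, ∀ᵐ x ∂μ, ‖g x‖ = r := by
      refine hT.ae_eq_const_of_ae_eq_comp_ae (g := fun x => ‖g x‖)
        hgm.norm.aestronglyMeasurable ?_
      filter_upwards [hgT] with x hx
      simp only [Function.comp_apply]
      rw [hx, norm_mul, SpecialFlow.norm_phase, one_mul]
    rcases eq_or_ne r 0 with rfl | hr0
    · refine ⟨0, ?_⟩
      filter_upwards [hgF, hlift hr] with z hz hz'
      rw [hz, norm_eq_zero.1 hz', mul_zero]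
    · have hr' : (r : ℂ) ≠ 0 := by exact_mod_cast hr0
      have hrpos : 0 ≤ r := by
        obtain ⟨x, hx⟩ := hr.exists
        exact hx ▸ norm_nonneg _
      have hs : s = 0 := by
        refine SpecialFlow.eq_zero_of_phase_eq_one hη₀ fun η h1 h2 => ?_
        refine SpecialFlow.phase_eq_one_of_drift hd μ hap (h η h1 h2)
          (g := fun x => (r : ℂ)⁻¹ * g x) (hgm.const_mul _) ?_ ?_
        · filter_upwards [hr] with x hx
          rw [norm_mul, hx, norm_inv, Complex.norm_real, Real.norm_of_nonneg hrpos,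
            inv_mul_cancel₀ hr0]
        · filter_upwards [hgT] with x hx
          rw [hx]
          ring
      have hph : ∀ t, SpecialFlow.phase s t = 1 := fun t => by simp [SpecialFlow.phase, hs]
      obtain ⟨a, ha⟩ := hT.ae_eq_const_of_ae_eq_comp_ae hgm.aestronglyMeasurable
        (by filter_upwards [hgT] with x hx
            rw [Function.comp_apply, hx, hph, one_mul])
      refine ⟨a, ?_⟩
      filter_upwards [hgF, hlift ha] with z hz hz'
      rw [hz, hph, one_mul, hz', Function.const_apply]
  · refine ⟨(hP'.add isCompact_Icc).diff isOpen_Ioo, fun h0 => h0.2 ⟨by linarith, by linarith⟩, ?_⟩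
    intro ε hε
    -- `η₀/2` is the length of the removed interval, so adding it to a point inside leads outside.
    obtain ⟨κ, hκ, hN⟩ := h (η₀ / 2) (by linarith) (by linarith) ε hε
    refine ⟨κ, hκ, fun N => ?_⟩
    obtain ⟨δ, hδ, Z, hZ, hZμ, hZd⟩ := hN N
    refine ⟨δ, hδ, Z, hZ, hZμ, fun x hx x' hx' h1 h2 => ?_⟩
    obtain ⟨M₁, M₂, L₁, L₂, hM₁, hM₂, hL₁, hL₂, hML₁, hML₂, p, hp, hp₁, hp₂⟩ :=
      hZd x hx x' hx' h1 h2
    by_cases hpI : p ∈ Set.Ioo (-(η₀ / 4)) (η₀ / 4)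
    · refine ⟨M₂, L₂, hM₂, hL₂, hML₂, p + η₀ / 2,
        ⟨Set.add_mem_add hp ⟨by linarith, by linarith⟩, fun hI => ?_⟩, hp₂⟩
      linarith [hpI.1, hI.2]
    · refine ⟨M₁, L₁, hM₁, hL₁, hML₁, p, ⟨?_, hpI⟩, hp₁⟩
      have := Set.add_mem_add hp (show (0 : ℝ) ∈ Set.Icc (-η₀) η₀ from ⟨by linarith, by linarith⟩)
      rwa [add_zero] at this
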